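/- Words are finite binary words, $|w|$ is the length of $w$, and $\mu$ is the uniform (Lebesgue) measure on $\{0,1\}^{\mathbb N}$. For a language $L$ let $[L]\subseteq\{0,1\}^{\mathbb N}$ be the class of all infinite sequences having a prefix in $L$. An automatic family is a family of languages $(U_i)_{i\in I}$ such that $I\subseteq\{0,1\}^*$ is regular and the relation $\{(x,i) : i\in I,\ x\in U_i\}$ is automatic, i.e. some finite automaton, reading $x$ and $i$ in parallel letter by letter with the shorter word padded at its end by a special symbol, accepts exactly the pairs in the relation. An automatic family is an ART if $\liminf_{i\in I}\mu[U_i]=0$ (along the words $i\in I$ as $|i|\to\infty$; in particular $I$ is infinite). It is a MART (Martin-Löf automatic randomness test) if $I$ is infinite and $\mu[U_i]\le 2^{-|i|}$ for all $i\in I$. Two such tests $(U_i)_{i\in I}$ and $(V_j)_{j\in J}$ are equivalent if $\bigcap_{i\in I}[U_i]=\bigcap_{j\in J}[V_j]$. **Theorem 1 (Assumptions on ART).** For every ART $(U_i)_{i\in I}$ there is an equivalent ART $(V_j)_{j\in J}$ such that 1. $J=0^*$; 2. $V_i\supseteq V_j$ for all $i,j\in J$ such that $i$ is a strict prefix of $j$;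 3. $|x|>|i|$ for all $i\in J$ and all $x\in V_i$. Likewise, for every MART $(U_i)_{i\in I}$ there is an equivalent MART $(V_j)_{j\in J}$ with properties 1-3. -/

import Mathlib

open MeasureTheory
open scoped ENNReal

noncomputable section

/-- Words over the binary alphabet; `false` is the letter `0`, `true` is the letter `1`. -/
abbrev Word : Type := List Bool

/-- Infinite binary sequences (the Cantor space). -/
abbrev CantorSeq : Type := ℕ → Bool

/-- Convolution of two words: the word of pairs of letters read in parallel, of the length of the
longer word, where the shorter word is padded at its end (`none` is the padding symbol). -/
def wordConv (x y : Word) : List (Option Bool × Option Bool) :=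
  List.zipWithAll Prod.mk x y

/-- A binary relation on words is automatic if some finite automaton over pairs of (padded) letters
accepts the convolution of `x` and `y` exactly when `x` and `y` are related. -/
def IsAutomaticRel (R : Word → Word → Prop) : Prop :=
  ∃ L : Language (Option Bool × Option Bool), L.IsRegular ∧ ∀ x y, wordConv x y ∈ L ↔ R x y

/-- A family of languages `(U i)`, `i ∈ I`, is an automatic family if `I` is a regular language and
the relation `x ∈ U i` between `x` and `i` is automatic. -/
def IsAutomaticFamily (I : Language Bool) (U : {i : Word // i ∈ I} → Language Bool) : Prop :=
  I.IsRegular ∧ IsAutomaticRel (fun x i => ∃ h : i ∈ I, x ∈ U ⟨i, h⟩)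

/-- The word `w` is a prefix of the sequence `X`. -/
def IsPrefixOfSeq (w : Word) (X : CantorSeq) : Prop :=
  ∀ (n : ℕ) (h : n < w.length), X n = w[n]

/-- The class `[L]` of all sequences that extend some word of `L`. -/
def langClass (L : Language Bool) : Set CantorSeq :=
  {X | ∃ w ∈ L, IsPrefixOfSeq w X}

/-- The Lebesgue measure on the Cantor space: the product of the uniform measures on `{0, 1}`. -/
def cantorMeasure : Measure CantorSeq :=
  Measure.infinitePi (fun _ : ℕ => (PMF.uniformOfFintype Bool).toMeasure)

/-- Automatic randomness tests: automatic families for which the lower limit, along the index set,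
of the measures of the classes `[U i]` is zero. As there are only finitely many words of each
length, the cofinite filter on `I` is the filter given by letting the length of `i` tend to
infinity. -/
def IsART (I : Language Bool) (U : {i : Word // i ∈ I} → Language Bool) : Prop :=
  IsAutomaticFamily I U ∧
    Filter.liminf (fun i => cantorMeasure (langClass (U i))) Filter.cofinite = 0

/-- Martin-Löf automatic randomness tests. -/
def IsMART (I : Language Bool) (U : {i : Word // i ∈ I} → Language Bool) : Prop :=
  IsAutomaticFamily I U ∧
    ∀ i, cantorMeasure (langClass (U i)) ≤ (2⁻¹ : ℝ≥0∞) ^ i.1.length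

/-- The covering region of a family of languages. -/
def coveringRegion {I : Language Bool} (U : {i : Word // i ∈ I} → Language Bool) :
    Set CantorSeq :=
  ⋂ i, langClass (U i)

/-- Two families are equivalent if they have the same covering region. -/
def TestEquiv {I J : Language Bool} (U : {i : Word // i ∈ I} → Language Bool)
    (V : {j : Word // j ∈ J} → Language Bool) : Prop :=
  coveringRegion U = coveringRegion V

/-- The language `0^*`. -/
def zeroStar : Language Bool :=
  {w : Word | ∃ n : ℕ, w = List.replicate n false}

end

/-! Let $V_j$ consist of the words $x$ with $|x|>|j|+c$ that have a prefix in every $U_i$ with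
$|i|\le|j|+c$. Then $[V_j]$ is the finite intersection of these $[U_i]$, so the covering region is
unchanged and the $V_j$ decrease. Since $x$ is longer than every $i$ quantified over, guessing a
prefix of $x$ and guessing $i$ are both subset constructions; this gives automaticity for $c=0$
(`isAutomaticRel_cumulative_zero`), and `IsAutomaticRel.append_replicate` adds the shift. For an
ART, $c=0$ works: one $U_i$ of small measure bounds all later $V_j$. For a MART, pumping bounds the
gaps between lengths in $I$ by some $c$, so some $i$ with $|j|\le|i|\le|j|+c$ gives $\mu[V_j]\le
2^{-|i|}\le 2^{-|j|}$. -/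

@[simp]
theorem wordConv_nil_nil : wordConv [] [] = [] := rfl

@[simp]
theorem wordConv_cons_nil (a : Bool) (x : Word) :
    wordConv (a :: x) [] = (some a, none) :: wordConv x [] := by
  simp [wordConv]

@[simp]
theorem wordConv_nil_cons (b : Bool) (y : Word) :
    wordConv [] (b :: y) = (none, some b) :: wordConv [] y := by
  simp [wordConv]

@[simp]
theorem wordConv_cons_cons (a b : Bool) (x y : Word) :
    wordConv (a :: x) (b :: y) = (some a, some b) :: wordConv x y := by
  simp [wordConv]

theorem replicate_mem_zeroStar (n : ℕ) : List.replicate n false ∈ zeroStar := ⟨n, rfl⟩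

theorem eq_replicate_of_mem_zeroStar {j : Word} (h : j ∈ zeroStar) :
    j = List.replicate j.length false := by
  obtain ⟨n, rfl⟩ := h
  simp

theorem mem_zeroStar_iff {j : Word} : j ∈ zeroStar ↔ ∀ b ∈ j, b = false :=
  ⟨fun ⟨_, hn⟩ _ hb => List.eq_of_mem_replicate (hn ▸ hb),
    fun h => ⟨j.length, List.eq_replicate_iff.2 ⟨rfl, h⟩⟩⟩

theorem isRegular_zeroStar : zeroStar.IsRegular := by
  let M : DFA Bool Bool := ⟨fun s b => s && !b, true, {true}⟩
  refine ⟨Bool, inferInstance, M, ?_⟩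
  have key : ∀ (j : Word) (s : Bool), M.evalFrom s j = true ↔ s = true ∧ ∀ b ∈ j, b = false := by
    intro j
    induction j with
    | nil => simp
    | cons b j ih =>
      intro s
      rw [DFA.evalFrom_cons, ih]
      simp [M, and_assoc]
  ext j
  rw [mem_zeroStar_iff]
  refine (key j true).trans ?_
  simp

/-! ### Closure properties of automatic relations -/

/-- Membership of the second word in a regular language is automatic. -/
theorem exists_isRegular_snd_mem {K : Language Bool} (hK : K.IsRegular) :
    ∃ L : Language (Option Bool × Option Bool), L.IsRegular ∧
      ∀ x i, wordConv x i ∈ L ↔ i ∈ K := by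
  obtain ⟨σ, _, A, rfl⟩ := hK
  let M : DFA (Option Bool × Option Bool) σ :=
    ⟨fun s p => p.2.elim s (A.step s), A.start, A.accept⟩
  refine ⟨M.accepts, ⟨σ, inferInstance, M, rfl⟩, ?_⟩
  have key : ∀ (x i : Word) (s : σ), M.evalFrom s (wordConv x i) = A.evalFrom s i := by
    intro x
    induction x with
    | nil =>
      intro i
      induction i with
      | nil => simp
      | cons b i ih => intro s; simp [ih, M]
    | cons a x ih =>
      intro i s
      cases i with
      | nil => simp [ih, M]
      | cons b i => simp [ih, M]
  intro x i
  change M.evalFrom A.start _ ∈ A.accept ↔ A.evalFrom A.start _ ∈ A.accept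
  rw [key]

/-- Being longer is an automatic relation. -/
theorem exists_isRegular_length_lt :
    ∃ L : Language (Option Bool × Option Bool), L.IsRegular ∧
      ∀ x i, wordConv x i ∈ L ↔ i.length < x.length := by
  let M : DFA (Option Bool × Option Bool) Bool := ⟨fun s p => s || p.2.isNone, false, {true}⟩
  refine ⟨M.accepts, ⟨Bool, inferInstance, M, rfl⟩, ?_⟩
  have key : ∀ (x i : Word) (s : Bool),
      M.evalFrom s (wordConv x i) = true ↔ s = true ∨ i.length < x.length := by
    intro x
    induction x with
    | nil =>
      intro i
      induction i with
      | nil => simp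
      | cons b i ih => intro s; simp [ih, M]
    | cons a x ih =>
      intro i s
      cases i with
      | nil => simp [ih, M]
      | cons b i => simp [ih, M]
  intro x i
  refine (key x i false).trans ?_
  simp

/-- Existence of a prefix of the first, longer word for which an automatic relation holds is
automatic. -/
theorem exists_isRegular_prefix {L : Language (Option Bool × Option Bool)} (hL : L.IsRegular) :
    ∃ L' : Language (Option Bool × Option Bool), L'.IsRegular ∧
      ∀ x i, i.length ≤ x.length →
        (wordConv x i ∈ L' ↔ ∃ y, y <+: x ∧ wordConv y i ∈ L) := by
  classical
  obtain ⟨σ, _, A, rfl⟩ := hL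
  -- The first component runs `A` on $(x,i)$ itself; the set holds the runs for prefixes $y$ that
  -- have already ended. Inserting `s.1` lets $y$ end here. Once $i$ has ended too, the convolution
  -- of $y$ and $i$ is over and these states stay put.
  let M : DFA (Option Bool × Option Bool) (σ × Set σ) :=
    ⟨fun s p => (A.step s.1 p,
      p.2.elim (insert s.1 s.2) fun b => (fun q => A.step q (none, some b)) '' insert s.1 s.2),
      (A.start, ∅), {s | ∃ q ∈ insert s.1 s.2, q ∈ A.accept}⟩
  refine ⟨M.accepts, ⟨_, inferInstance, M, rfl⟩, ?_⟩
  have key : ∀ (x i : Word) (s : σ) (P : Set σ), i.length ≤ x.length →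
      (M.evalFrom (s, P) (wordConv x i) ∈ M.accept ↔
        (∃ q ∈ P, A.evalFrom q (wordConv [] i) ∈ A.accept) ∨
          ∃ y, y <+: x ∧ A.evalFrom s (wordConv y i) ∈ A.accept) := by
    intro x
    induction x with
    | nil =>
      intro i s P h
      obtain rfl : i = [] := List.length_eq_zero_iff.1 (Nat.le_zero.1 h)
      simp [M, or_comm]
    | cons a x ih =>
      intro i s P h
      cases i with
      | nil =>
        rw [wordConv_cons_nil, DFA.evalFrom_cons]
        refine (ih [] _ _ (Nat.zero_le _)).trans ?_
        simp only [List.prefix_cons_iff, Option.elim]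
        constructor
        · rintro (⟨q, rfl | hq, h⟩ | ⟨y, hy, h⟩)
          · exact .inr ⟨[], .inl rfl, h⟩
          · exact .inl ⟨q, hq, h⟩
          · exact .inr ⟨a :: y, .inr ⟨y, rfl, hy⟩, by simpa using h⟩
        · rintro (⟨q, hq, h⟩ | ⟨_, rfl | ⟨y, rfl, hy⟩, h⟩)
          · exact .inl ⟨q, .inr hq, h⟩
          · exact .inl ⟨s, .inl rfl, h⟩
          · exact .inr ⟨y, hy, by simpa using h⟩
      | cons b i =>
        rw [wordConv_cons_cons, DFA.evalFrom_cons]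
        refine (ih i _ _ (by simpa using h)).trans ?_
        simp only [List.prefix_cons_iff, Option.elim, wordConv_nil_cons, DFA.evalFrom_cons]
        constructor
        · rintro (⟨_, ⟨q, rfl | hq, rfl⟩, h⟩ | ⟨y, hy, h⟩)
          · exact .inr ⟨[], .inl rfl, by simpa using h⟩
          · exact .inl ⟨q, hq, h⟩
          · exact .inr ⟨a :: y, .inr ⟨y, rfl, hy⟩, by simpa using h⟩
        · rintro (⟨q, hq, h⟩ | ⟨_, rfl | ⟨y, rfl, hy⟩, h⟩)
          · exact .inl ⟨_, ⟨q, .inr hq, rfl⟩, h⟩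
          · exact .inl ⟨_, ⟨s, .inl rfl, rfl⟩, by simpa using h⟩
          · exact .inr ⟨y, hy, by simpa using h⟩
  intro x i h
  refine (key x i A.start ∅ h).trans ?_
  simp only [Set.mem_empty_iff_false, false_and, exists_false, false_or]
  rfl

/-- Projection of the second word to its length: the existence of a related word of length at most
`n` is recognisable from the convolution with `0^n`. -/
theorem exists_isRegular_exists_length_le {L : Language (Option Bool × Option Bool)}
    (hL : L.IsRegular) :
    ∃ L' : Language (Option Bool × Option Bool), L'.IsRegular ∧
      ∀ x n, n ≤ x.length →
        (wordConv x (List.replicate n false) ∈ L' ↔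
          ∃ i : Word, i.length ≤ n ∧ wordConv x i ∈ L) := by
  classical
  obtain ⟨σ, _, A, rfl⟩ := hL
  -- The two components hold the states for the words `i` that have not, or have, ended before the
  -- current position.
  let M : DFA (Option Bool × Option Bool) (Set σ × Set σ) :=
    -- Padding in the second track means that $0^n$ is used up: no guessed $i$ may continue, so its
    -- run can only pass to the second component.
    ⟨fun s p => (if p.2 = none then ∅ else {q | ∃ r ∈ s.1, ∃ b, A.step r (p.1, some b) = q},
      {q | ∃ r ∈ s.1 ∪ s.2, A.step r (p.1, none) = q}),
      ({A.start}, ∅), {s | ∃ q ∈ s.1 ∪ s.2, q ∈ A.accept}⟩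
  refine ⟨M.accepts, ⟨_, inferInstance, M, rfl⟩, ?_⟩
  have key : ∀ (x : Word) (n : ℕ) (P D : Set σ), n ≤ x.length →
      (M.evalFrom (P, D) (wordConv x (List.replicate n false)) ∈ M.accept ↔
        (∃ q ∈ D, A.evalFrom q (wordConv x []) ∈ A.accept) ∨
          ∃ q ∈ P, ∃ i : Word, i.length ≤ n ∧ A.evalFrom q (wordConv x i) ∈ A.accept) := by
    intro x
    induction x with
    | nil =>
      intro n P D h
      obtain rfl : n = 0 := Nat.le_zero.1 h
      simp [M, or_and_right, exists_or, or_comm]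
    | cons a x ih =>
      intro n P D h
      cases n with
      | zero =>
        rw [List.replicate_zero, wordConv_cons_nil, DFA.evalFrom_cons]
        refine (ih 0 _ _ (Nat.zero_le _)).trans ?_
        simp [or_and_right, exists_or, or_comm]
      | succ n =>
        rw [List.replicate_succ, wordConv_cons_cons, DFA.evalFrom_cons]
        refine (ih n _ _ (by simpa using h)).trans ?_
        constructor
        · rintro (⟨_, ⟨r, hr | hr, rfl⟩, h⟩ | ⟨_, ⟨r, hr, b, rfl⟩, i, hi, h⟩)
          · exact .inr ⟨r, hr, [], by simp, by simpa using h⟩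
          · exact .inl ⟨r, hr, by simpa using h⟩
          · exact .inr ⟨r, hr, b :: i, by simpa using hi, by simpa using h⟩
        · rintro (⟨r, hr, h⟩ | ⟨r, hr, i, hi, h⟩)
          · exact .inl ⟨_, ⟨r, .inr hr, rfl⟩, by simpa using h⟩
          · cases i with
            | nil => exact .inl ⟨_, ⟨r, .inl hr, rfl⟩, by simpa using h⟩
            | cons b i =>
              exact .inr ⟨_, ⟨r, hr, b, rfl⟩, i, by simpa using hi, by simpa using h⟩
  intro x n h
  refine (key x n {A.start} ∅ h).trans ?_
  simp only [Set.mem_empty_iff_false, false_and, exists_false, false_or, Set.mem_singleton_iff,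
    exists_eq_left]
  rfl

/-- Appending a letter to the second word preserves automaticity of relations that hold only if the
first word is at least as long as the second. -/
theorem IsAutomaticRel.append_singleton {R : Word → Word → Prop} (hR : IsAutomaticRel R)
    (hlen : ∀ x j, R x j → j.length ≤ x.length) (b : Bool) :
    IsAutomaticRel fun x j => R x (j ++ [b]) := by
  obtain ⟨L, ⟨σ, _, A, rfl⟩, hA⟩ := hR
  -- The first padding symbol below $x$ is read as `b`, and the flag records that this has happened.
  -- Such a position exists exactly when $|j|<|x|$, which `hlen` guarantees for related pairs.
  let M : DFA (Option Bool × Option Bool) (σ × Bool) :=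
    ⟨fun s p => (A.step s.1 (if s.2 = false ∧ p.2 = none then (p.1, some b) else p),
      s.2 || p.2.isNone), (A.start, false), {s | s.2 = true ∧ s.1 ∈ A.accept}⟩
  have keyT : ∀ (w : List (Option Bool × Option Bool)) (s : σ),
      M.evalFrom (s, true) w = (A.evalFrom s w, true) := by
    intro w
    induction w with
    | nil => simp
    | cons p w ih => intro s; simp [M, ← ih]
  have key : ∀ (x j : Word) (s : σ), M.evalFrom (s, false) (wordConv x j) ∈ M.accept ↔
      j.length < x.length ∧ A.evalFrom s (wordConv x (j ++ [b])) ∈ A.accept := by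
    intro x
    induction x with
    | nil =>
      intro j
      induction j with
      | nil => simp [M]
      | cons c j ih => intro s; simpa [M] using ih _
    | cons a x ih =>
      intro j s
      cases j with
      | nil =>
        have := keyT (wordConv x []) (A.step s (some a, some b))
        rw [wordConv_cons_nil, DFA.evalFrom_cons]
        change M.evalFrom (A.step s (some a, some b), true) _ ∈ _ ↔ _
        rw [this]
        simp [M]
      | cons c j =>
        rw [wordConv_cons_cons, DFA.evalFrom_cons]
        change M.evalFrom (A.step s (some a, some c), false) _ ∈ _ ↔ _
        rw [ih]
        simp
  refine ⟨M.accepts, ⟨_, inferInstance, M, rfl⟩, fun x j => (key x j A.start).trans ?_⟩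
  change _ ∧ wordConv x (j ++ [b]) ∈ A.accepts ↔ R x (j ++ [b])
  rw [hA]
  refine and_iff_right_of_imp fun h => ?_
  simpa using hlen _ _ h

theorem IsAutomaticRel.append_replicate {R : Word → Word → Prop} (hR : IsAutomaticRel R)
    (hlen : ∀ x j, R x j → j.length ≤ x.length) (b : Bool) (c : ℕ) :
    IsAutomaticRel fun x j => R x (j ++ List.replicate c b) := by
  induction c with
  | zero => simpa using hR
  | succ c ih =>
    have := ih.append_singleton (fun x j h => by
      have := hlen _ _ h
      simp only [List.length_append] at this
      omega) b
    simpa [List.replicate_succ] using this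

/-! ### The cumulative test -/

/-- The words longer than `|j| + c` that have a prefix in each `U i` with `|i| ≤ |j| + c`. -/
def cumulativeFamily {I : Language Bool} (U : {i : Word // i ∈ I} → Language Bool) (c : ℕ)
    (j : {j : Word // j ∈ zeroStar}) : Language Bool :=
  {x | j.1.length + c < x.length ∧
    ∀ i : {i : Word // i ∈ I}, i.1.length ≤ j.1.length + c → ∃ y, y <+: x ∧ y ∈ U i}

section cumulativeFamily

variable {I : Language Bool} {U : {i : Word // i ∈ I} → Language Bool}

/-- The universal quantifier is the complement of a projection: no $i\in I$ of length at most $|j|$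
lacks a prefix of $x$ in $U_i$. As $j=0^{|j|}$, the second track carries just the length bound. -/
theorem isAutomaticRel_cumulative_zero (hU : IsAutomaticFamily I U) :
    IsAutomaticRel fun x j => j ∈ zeroStar ∧ j.length < x.length ∧
      ∀ i : {i : Word // i ∈ I}, i.1.length ≤ j.length → ∃ y, y <+: x ∧ y ∈ U i := by
  obtain ⟨hI, L, hL, hLU⟩ := hU
  obtain ⟨P, hP, hPL⟩ := exists_isRegular_prefix hL
  obtain ⟨K, hK, hKI⟩ := exists_isRegular_snd_mem hI
  obtain ⟨Z, hZ, hZs⟩ := exists_isRegular_snd_mem isRegular_zeroStar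
  obtain ⟨T, hT, hTl⟩ := exists_isRegular_length_lt
  obtain ⟨E, hE, hEl⟩ := exists_isRegular_exists_length_le (hK.inf hP.compl)
  refine ⟨Z ⊓ (T ⊓ Eᶜ), hZ.inf (hT.inf hE.compl), fun x j => ?_⟩
  change wordConv x j ∈ Z ∧ wordConv x j ∈ T ∧ ¬ wordConv x j ∈ E ↔ _
  rw [hZs, hTl]
  refine and_congr_right fun hj => and_congr_right fun hlt => ?_
  have h := hEl x j.length hlt.le
  rw [← eq_replicate_of_mem_zeroStar hj] at h
  rw [h]
  push Not
  refine ⟨fun H i hi => ?_, fun H i hi hmem => ?_⟩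
  · by_contra hcon
    refine H i.1 hi ⟨(hKI _ _).2 i.2, fun hmem => hcon ?_⟩
    obtain ⟨y, hy, hyL⟩ := (hPL x i.1 (hi.trans hlt.le)).1 hmem
    exact ⟨y, hy, ((hLU y i.1).1 hyL).2⟩
  · have hiI := (hKI _ _).1 hmem.1
    obtain ⟨y, hy, hyU⟩ := H ⟨i, hiI⟩ hi
    exact hmem.2 ((hPL x i (hi.trans hlt.le)).2 ⟨y, hy, (hLU y i).2 ⟨hiI, hyU⟩⟩)

theorem append_replicate_mem_zeroStar {j : Word} (c : ℕ) :
    j ++ List.replicate c false ∈ zeroStar ↔ j ∈ zeroStar := by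
  simp only [mem_zeroStar_iff, List.mem_append]
  refine ⟨fun h b hb => h b (.inl hb), fun h b hb => ?_⟩
  exact hb.elim (h b) List.eq_of_mem_replicate

theorem isAutomaticFamily_cumulativeFamily (hU : IsAutomaticFamily I U) (c : ℕ) :
    IsAutomaticFamily zeroStar (cumulativeFamily U c) := by
  refine ⟨isRegular_zeroStar, ?_⟩
  have h := (isAutomaticRel_cumulative_zero hU).append_replicate
    (fun x j h => h.2.1.le) false c
  convert h using 3 with x j
  rw [append_replicate_mem_zeroStar, List.length_append, List.length_replicate]
  exact ⟨fun ⟨h, hx⟩ => ⟨h, hx⟩, fun ⟨h, hx⟩ => ⟨h, hx⟩⟩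

theorem prefix_of_isPrefixOfSeq {v w : Word} {X : CantorSeq} (hv : IsPrefixOfSeq v X)
    (hw : IsPrefixOfSeq w X) (h : v.length ≤ w.length) : v <+: w := by
  rw [List.prefix_iff_getElem]
  exact ⟨h, fun n hn => (hv n hn).symm.trans (hw n (hn.trans_le h))⟩

theorem IsPrefixOfSeq.of_prefix {v w : Word} {X : CantorSeq} (hw : IsPrefixOfSeq w X)
    (h : v <+: w) : IsPrefixOfSeq v X := fun n hn =>
  (hw n (hn.trans_le h.length_le)).trans (h.getElem hn).symm

theorem isPrefixOfSeq_ofFn (X : CantorSeq) (n : ℕ) :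
    IsPrefixOfSeq (List.ofFn fun k : Fin n => X k) X := by
  intro k hk
  simp

theorem langClass_cumulativeFamily (U : {i : Word // i ∈ I} → Language Bool) (c : ℕ)
    (j : {j : Word // j ∈ zeroStar}) :
    langClass (cumulativeFamily U c j) =
      {X | ∀ i : {i : Word // i ∈ I}, i.1.length ≤ j.1.length + c → X ∈ langClass (U i)} := by
  ext X
  constructor
  · rintro ⟨w, ⟨-, hw⟩, hX⟩ i hi
    obtain ⟨y, hy, hyU⟩ := hw i hi
    exact ⟨y, hyU, hX.of_prefix hy⟩
  · intro hX
    choose! y hyU hyX using hX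
    have hfin : {i : {i : Word // i ∈ I} | i.1.length ≤ j.1.length + c}.Finite :=
      (List.finite_length_le Bool (j.1.length + c)).preimage Subtype.val_injective.injOn
    obtain ⟨N, hN⟩ := (hfin.image fun i => (y i).length).bddAbove
    -- Only finitely many $i$ occur, so one prefix of $X$ extends all witnesses `y i`; the other
    -- term of the maximum secures the strict length bound.
    refine ⟨List.ofFn fun k : Fin (max N (j.1.length + c + 1)) => X k, ⟨?_, fun i hi => ?_⟩,
      isPrefixOfSeq_ofFn _ _⟩
    · rw [List.length_ofFn]
      omega
    · refine ⟨y i, prefix_of_isPrefixOfSeq (hyX i hi) (isPrefixOfSeq_ofFn _ _) ?_, hyU i hi⟩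
      rw [List.length_ofFn]
      exact (hN ⟨i, hi, rfl⟩).trans (le_max_left _ _)

theorem testEquiv_cumulativeFamily (U : {i : Word // i ∈ I} → Language Bool) (c : ℕ) :
    TestEquiv U (cumulativeFamily U c) := by
  ext X
  simp only [coveringRegion, Set.mem_iInter, langClass_cumulativeFamily]
  refine ⟨fun h j i _ => h i, fun h i => ?_⟩
  exact h ⟨_, replicate_mem_zeroStar i.1.length⟩ i (by simp)

theorem cumulativeFamily_anti (U : {i : Word // i ∈ I} → Language Bool) (c : ℕ)
    {i j : {j : Word // j ∈ zeroStar}} (h : i.1.length ≤ j.1.length) :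
    cumulativeFamily U c j ≤ cumulativeFamily U c i := fun _ hx =>
  ⟨(Nat.add_le_add_right h c).trans_lt hx.1,
    fun k hk => hx.2 k (hk.trans (Nat.add_le_add_right h c))⟩

theorem cantorMeasure_cumulativeFamily_le (U : {i : Word // i ∈ I} → Language Bool) (c : ℕ)
    (j : {j : Word // j ∈ zeroStar}) (i : {i : Word // i ∈ I})
    (h : i.1.length ≤ j.1.length + c) :
    cantorMeasure (langClass (cumulativeFamily U c j)) ≤ cantorMeasure (langClass (U i)) := by
  refine measure_mono ?_
  rw [langClass_cumulativeFamily]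
  exact fun X hX => hX i h

theorem infinite_zeroStar : Infinite {j : Word // j ∈ zeroStar} :=
  Infinite.of_injective (fun n : ℕ => ⟨_, replicate_mem_zeroStar n⟩) fun m n h => by
    simpa using congrArg (fun j => j.1.length) h

theorem isART_cumulativeFamily (hU : IsART I U) (c : ℕ) :
    IsART zeroStar (cumulativeFamily U c) := by
  refine ⟨isAutomaticFamily_cumulativeFamily hU.1 c, ?_⟩
  -- Makes the cofinite filter nontrivial, so that "eventually" implies "frequently" below.
  have := infinite_zeroStar
  refine le_antisymm (le_of_forall_gt fun ε hε => ?_) zero_le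
  obtain ⟨δ, hδ, hδε⟩ := exists_between hε
  obtain ⟨i, hi⟩ := (Filter.frequently_lt_of_liminf_lt (h := hU.2 ▸ hδ)).exists
  refine lt_of_le_of_lt (Filter.liminf_le_of_frequently_le' ?_) hδε
  have hev : ∀ᶠ j : {j : Word // j ∈ zeroStar} in Filter.cofinite, i.1.length ≤ j.1.length := by
    rw [Filter.eventually_cofinite]
    simp only [not_le]
    exact (List.finite_length_lt Bool i.1.length).preimage Subtype.val_injective.injOn
  exact (hev.mono fun j hj =>
    (cantorMeasure_cumulativeFamily_le U c j i (by omega)).trans hi.le).frequently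

end cumulativeFamily

/-! ### Bounded gaps and Martin-Löf tests -/

/-- The gaps between the lengths of the words of an infinite regular language are bounded. -/
theorem Language.IsRegular.exists_length_mem_Icc {α : Type*} [Finite α] {I : Language α}
    (hI : I.IsRegular) (hinf : Infinite {i : List α // i ∈ I}) :
    ∃ c, ∀ n, ∃ i ∈ I, n ≤ i.length ∧ i.length ≤ n + c := by
  classical
  obtain ⟨σ, _, A, rfl⟩ := hI
  refine ⟨Fintype.card σ, fun n => ?_⟩
  have hex : ∃ m, n ≤ m ∧ ∃ i ∈ A.accepts, i.length = m := by
    by_contra! hcon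
    refine hinf.not_finite ((List.finite_length_lt α n).subset fun i hi => ?_).to_subtype
    by_contra hlt
    exact hcon i.length (not_lt.1 hlt) i hi rfl
  obtain ⟨hn, i, hi, him⟩ := Nat.find_spec hex
  refine ⟨i, hi, him ▸ hn, ?_⟩
  by_contra! hlt
  -- If the least length $m\ge n$ in the language exceeded $n+|\sigma|$, deleting the pumped factor,
  -- of length between $1$ and $|\sigma|$, would leave a shorter word still of length at least $n$.
  obtain ⟨a, b, d, rfl, hab, hb, hsub⟩ := A.pumping_lemma hi (by omega)
  have hmem : a ++ d ∈ A.accepts := by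
    refine hsub ⟨a, ⟨a, rfl, [], Language.nil_mem_kstar _, by simp⟩, d, rfl, rfl⟩
  have hbpos := List.length_pos_iff.2 hb
  simp only [List.length_append] at him hlt
  exact Nat.find_min hex (m := (a ++ d).length) (by rw [List.length_append]; omega)
    ⟨by rw [List.length_append]; omega, _, hmem, rfl⟩

theorem IsMART.exists_isMART_cumulativeFamily {I : Language Bool}
    {U : {i : Word // i ∈ I} → Language Bool} (hU : IsMART I U)
    (hinf : Infinite {i : Word // i ∈ I}) : ∃ c, IsMART zeroStar (cumulativeFamily U c) := by
  obtain ⟨c, hc⟩ := hU.1.1.exists_length_mem_Icc hinf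
  refine ⟨c, isAutomaticFamily_cumulativeFamily hU.1 c, fun j => ?_⟩
  obtain ⟨i, hi, hji, hij⟩ := hc j.1.length
  exact ((cantorMeasure_cumulativeFamily_le U c j ⟨i, hi⟩ hij).trans (hU.2 ⟨i, hi⟩)).trans
    (pow_le_pow_right_of_le_one' (ENNReal.inv_le_one.2 one_le_two) hji)

theorem theorem1 :
    (∀ (I : Language Bool) (U : {i : Word // i ∈ I} → Language Bool), IsART I U →
      ∃ V : {j : Word // j ∈ zeroStar} → Language Bool,
        IsART zeroStar V ∧ TestEquiv U V ∧
        (∀ i j : {j : Word // j ∈ zeroStar}, i.1 <+: j.1 → i.1 ≠ j.1 → V j ≤ V i) ∧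
        (∀ (i : {j : Word // j ∈ zeroStar}) (x : Word), x ∈ V i → i.1.length < x.length)) ∧
    (∀ (I : Language Bool) (U : {i : Word // i ∈ I} → Language Bool),
      Infinite {i : Word // i ∈ I} → IsMART I U →
      ∃ V : {j : Word // j ∈ zeroStar} → Language Bool,
        IsMART zeroStar V ∧ TestEquiv U V ∧
        (∀ i j : {j : Word // j ∈ zeroStar}, i.1 <+: j.1 → i.1 ≠ j.1 → V j ≤ V i) ∧
        (∀ (i : {j : Word // j ∈ zeroStar}) (x : Word), x ∈ V i → i.1.length < x.length)) := by
  refine ⟨fun I U hU => ⟨cumulativeFamily U 0, isART_cumulativeFamily hU 0,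
    testEquiv_cumulativeFamily U 0, fun i j hij _ => cumulativeFamily_anti U 0 hij.length_le,
    fun i x hx => hx.1⟩, fun I U hinf hU => ?_⟩
  obtain ⟨c, hc⟩ := hU.exists_isMART_cumulativeFamily hinf
  exact ⟨cumulativeFamily U c, hc, testEquiv_cumulativeFamily U c,
    fun i j hij _ => cumulativeFamily_anti U c hij.length_le,
    fun i x hx => (Nat.le_add_right _ c).trans_lt hx.1⟩
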